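/- All vector lattices are real and Archimedean. Let $X$ be a vector lattice. A net $(x_\alpha)$ in $X$ converges uniformly to $x\in X$ if there is a regulator $e\in X_+$ such that for every $\varepsilon>0$ there is $\alpha_0$ with $|x_\alpha-x|\le\varepsilon e$ for all $\alpha\ge\alpha_0$. The net is uniformly Cauchy if the net $(x_\alpha-x_\beta)_{(\alpha,\beta)}$ converges uniformly to $0$, and $X$ is uniformly complete if every uniformly Cauchy net in $X$ converges uniformly in $X$. A subset of $X$ is uniformly closed in $X$ if it contains the limits of all nets of its elements that converge uniformly in $X$; the uniform closure of a set $A\subseteq X$ in $X$ is the intersection of all uniformly closed subsets of $X$ containing $A$ (it is a sublattice if $A$ is one; sublattices are understood to be linear subspaces). A sublattice $X$ of a vector lattice $Y$ is majorizing if for every $y\in Y_+$ there is $x\in X$ with $y\le x$. The uniform completion $X^{\rm ru}$ of a vector lattice $X$ is the intersection of all uniformly complete sublattices of the Dedekind (order) completion $X^\delta$ that contain $X$. Theorem. If $X$ is a majorizing sublattice of a uniformly complete vector lattice $Y$, then the uniform completion $X^{\rm ru}$ is lattice isomorphic to the uniform closure of $X$ in $Y$; that is, there is a linear bijection between them that preserves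 finite suprema and infima. Moreover, the isomorphism can be chosen to be the identity on $X$. -/

import Mathlib

universe u

set_option linter.unusedSectionVars false

namespace VectorLattice

/-! ### Archimedean vector lattices

A (real) vector lattice is a type with the instances
`[AddCommGroup X] [Lattice X] [IsOrderedAddMonoid X] [Module ℝ X] [IsOrderedModule ℝ X]`. -/

/-- A vector lattice is Archimedean if `n x ≤ y` for all `n` implies `x ≤ 0`.
(Mathlib's class `Archimedean` is a different notion, meant for linear orders.) -/
class IsArchimedean (X : Type*) [AddCommGroup X] [Lattice X] : Prop where
  le_zero_of_forall_nsmul_le : ∀ x y : X, (∀ n : ℕ, n • x ≤ y) → x ≤ 0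

/-! ### Relatively uniform convergence -/

section Uniform

variable {X : Type u} [AddCommGroup X] [Lattice X] [Module ℝ X]

/-- The net `f` converges to `x` uniformly relative to the regulator `e`. -/
def ConvergesRel {ι : Type*} [Preorder ι] (e : X) (f : ι → X) (x : X) : Prop :=
  ∀ ε : ℝ, 0 < ε → ∃ i₀, ∀ i, i₀ ≤ i → |f i - x| ≤ ε • e

/-- The net `f` converges to `x` (relatively) uniformly. -/
def Converges {ι : Type*} [Preorder ι] (f : ι → X) (x : X) : Prop :=
  ∃ e : X, 0 ≤ e ∧ ConvergesRel e f x

/-- A net is uniformly Cauchy if the net of its differences, indexed by `ι × ι`, converges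
uniformly to zero. -/
def IsCauchyNet {ι : Type*} [Preorder ι] (f : ι → X) : Prop :=
  Converges (fun p : ι × ι => f p.1 - f p.2) 0

variable (X) in
/-- Every uniformly Cauchy net converges uniformly. -/
def UniformlyComplete : Prop :=
  ∀ (ι : Type u) [Preorder ι] [IsDirectedOrder ι] [Nonempty ι] (f : ι → X),
    IsCauchyNet f → ∃ x, Converges f x

/-- A set is uniformly closed if it contains all uniform limits of nets of its elements. -/
def IsUniformlyClosed (A : Set X) : Prop :=
  ∀ (ι : Type u) [Preorder ι] [IsDirectedOrder ι] [Nonempty ι] (f : ι → X) (x : X),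
    (∀ i, f i ∈ A) → Converges f x → x ∈ A

/-- The uniform closure of a set: the intersection of all uniformly closed sets containing it. -/
def uniformClosure (A : Set X) : Set X :=
  ⋂₀ {B | IsUniformlyClosed B ∧ A ⊆ B}

theorem subset_uniformClosure (A : Set X) : A ⊆ uniformClosure A :=
  fun _ hx _ hB => hB.2 hx

theorem isUniformlyClosed_uniformClosure (A : Set X) : IsUniformlyClosed (uniformClosure A) :=
  fun ι _ _ _ f x hf hx B hB => hB.1 ι f x (fun i => hf i B hB) hx

theorem uniformClosure_subset {A B : Set X} (hB : IsUniformlyClosed B) (h : A ⊆ B) :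
    uniformClosure A ⊆ B :=
  fun _ hx => hx B ⟨hB, h⟩

end Uniform

/-! ### Sublattices -/

/-- A sublattice of a vector lattice: a linear subspace closed under `⊔` and `⊓`. -/
structure VectorSublattice (X : Type u) [AddCommGroup X] [Lattice X] [Module ℝ X] extends
  Submodule ℝ X, Sublattice X

namespace VectorSublattice

section Basic

variable {X : Type u} [AddCommGroup X] [Lattice X] [Module ℝ X]

instance : SetLike (VectorSublattice X) X where
  coe S := S.carrier
  coe_injective S T h := by
    obtain ⟨S, _, _⟩ := S
    obtain ⟨T, _, _⟩ := T
    have : S = T := SetLike.coe_injective h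
    subst this
    rfl

instance : AddSubgroupClass (VectorSublattice X) X where
  add_mem {S} _ _ ha hb := S.toSubmodule.add_mem ha hb
  zero_mem S := S.toSubmodule.zero_mem
  neg_mem {S} _ ha := S.toSubmodule.neg_mem ha

instance : SMulMemClass (VectorSublattice X) ℝ X where
  smul_mem {S} r _ ha := S.toSubmodule.smul_mem r ha

theorem sup_mem (S : VectorSublattice X) {x y : X} (hx : x ∈ S) (hy : y ∈ S) : x ⊔ y ∈ S :=
  S.supClosed' hx hy

theorem inf_mem (S : VectorSublattice X) {x y : X} (hx : x ∈ S) (hy : y ∈ S) : x ⊓ y ∈ S :=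
  S.infClosed' hx hy

instance (S : VectorSublattice X) : Lattice S :=
  Subtype.lattice (fun _ _ => S.sup_mem) (fun _ _ => S.inf_mem)

instance [IsOrderedAddMonoid X] (S : VectorSublattice X) : IsOrderedAddMonoid S where
  add_le_add_left _ _ h c := add_le_add_left (α := X) h c

instance [IsOrderedModule ℝ X] (S : VectorSublattice X) : IsOrderedModule ℝ S where
  smul_le_smul_of_nonneg_left _ hr _ _ h :=
    smul_le_smul_of_nonneg_left (α := ℝ) (β := X) h hr
  smul_le_smul_of_nonneg_right _ hb _ _ h :=
    smul_le_smul_of_nonneg_right (α := ℝ) (β := X) h hb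

instance [IsArchimedean X] (S : VectorSublattice X) : IsArchimedean S where
  le_zero_of_forall_nsmul_le x y h :=
    IsArchimedean.le_zero_of_forall_nsmul_le (x : X) (y : X) fun n => h n

/-- The intersection of a family of sublattices. -/
instance : InfSet (VectorSublattice X) where
  sInf 𝒜 :=
    { carrier := {x | ∀ S ∈ 𝒜, x ∈ S}
      add_mem' := fun ha hb S hS => add_mem (ha S hS) (hb S hS)
      zero_mem' := fun S _ => zero_mem S
      smul_mem' := fun r _ ha S hS => SMulMemClass.smul_mem r (ha S hS)
      supClosed' := fun _ ha _ hb S hS => S.sup_mem (ha S hS) (hb S hS)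
      infClosed' := fun _ ha _ hb S hS => S.inf_mem (ha S hS) (hb S hS) }

theorem mem_sInf {𝒜 : Set (VectorSublattice X)} {x : X} : x ∈ sInf 𝒜 ↔ ∀ S ∈ 𝒜, x ∈ S :=
  Iff.rfl

/-- `S` is majorizing in `X` if every positive `x` in `X` lies below some element of `S`. -/
def IsMajorizing (S : VectorSublattice X) : Prop :=
  ∀ x : X, 0 ≤ x → ∃ y ∈ S, x ≤ y

end Basic

/-! The uniform closure of a sublattice is a sublattice. -/

section Closure

variable {X : Type u} [AddCommGroup X] [Lattice X] [IsOrderedAddMonoid X]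
  [Module ℝ X] [IsOrderedModule ℝ X]

/-- The preimage of a uniformly closed set under a map that is Lipschitz for the modulus is
uniformly closed. -/
theorem isUniformlyClosed_preimage {B : Set X} (hB : IsUniformlyClosed B) (φ : X → X) (c : ℝ)
    (hc : 0 < c) (hφ : ∀ x y, |φ x - φ y| ≤ c • |x - y|) : IsUniformlyClosed (φ ⁻¹' B) := by
  rintro ι _ _ _ f x hf ⟨e, he, h⟩
  refine hB ι (fun i => φ (f i)) (φ x) hf ⟨e, he, fun ε hε => ?_⟩
  obtain ⟨i₀, hi₀⟩ := h (ε / c) (by positivity)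
  refine ⟨i₀, fun i hi => (hφ _ _).trans ?_⟩
  refine (smul_le_smul_of_nonneg_left (hi₀ i hi) hc.le).trans_eq ?_
  rw [smul_smul, mul_div_cancel₀ _ hc.ne']

theorem map_mem_uniformClosure (φ : X → X) (c : ℝ) (hc : 0 < c)
    (hφ : ∀ x y, |φ x - φ y| ≤ c • |x - y|) {A : Set X}
    (hA : ∀ x ∈ A, φ x ∈ uniformClosure A) {x : X} (hx : x ∈ uniformClosure A) :
    φ x ∈ uniformClosure A :=
  uniformClosure_subset
    (isUniformlyClosed_preimage (isUniformlyClosed_uniformClosure A) φ c hc hφ) hA hx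

theorem map₂_mem_uniformClosure (φ : X → X → X)
    (hφ : ∀ x y z, |φ x z - φ y z| ≤ |x - y|) (hφ' : ∀ x y z, |φ z x - φ z y| ≤ |x - y|)
    {A : Set X} (hA : ∀ x ∈ A, ∀ y ∈ A, φ x y ∈ A) {x y : X} (hx : x ∈ uniformClosure A)
    (hy : y ∈ uniformClosure A) : φ x y ∈ uniformClosure A := by
  refine map_mem_uniformClosure (φ x) 1 one_pos (by simpa using fun a b => hφ' a b x) ?_ hy
  intro z hz
  refine map_mem_uniformClosure (fun t => φ t z) 1 one_pos (by simpa using fun a b => hφ a b z)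
    ?_ hx
  exact fun t ht => subset_uniformClosure A (hA t ht z hz)

/-- The uniform closure of a sublattice `S` of `X` in `X`, as a sublattice of `X`. -/
def uniformClosure (S : VectorSublattice X) : VectorSublattice X where
  carrier := VectorLattice.uniformClosure (S : Set X)
  add_mem' := map₂_mem_uniformClosure (· + ·) (by simp) (by simp) fun _ hx _ hy => add_mem hx hy
  zero_mem' := subset_uniformClosure _ (zero_mem S)
  smul_mem' r x hx := by
    refine map_mem_uniformClosure (r • ·) (|r| + 1) (by positivity) ?_
      (fun x hx => subset_uniformClosure _ (SMulMemClass.smul_mem r hx)) hx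
    intro x y
    have h : |r • (x - y)| ≤ |r| • |x - y| := by
      rw [abs_le']
      have h1 := smul_le_smul_of_nonneg_left (le_abs_self (x - y)) (abs_nonneg r)
      have h2 := smul_le_smul_of_nonneg_left (neg_le_abs (x - y)) (abs_nonneg r)
      rcases abs_choice r with h | h <;> rw [h] at h1 h2 ⊢
      · exact ⟨h1, by rwa [smul_neg] at h2⟩
      · rw [neg_smul, neg_smul] at h1 h2
        rw [smul_neg, neg_neg] at h2
        rw [neg_smul]
        exact ⟨h2, h1⟩
    rw [← smul_sub, add_smul, one_smul]
    exact h.trans (le_add_of_nonneg_right (abs_nonneg _))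
  supClosed' := fun _ hx _ hy => map₂_mem_uniformClosure (· ⊔ ·)
    (fun x y z => abs_sup_sub_sup_le_abs x y z)
    (fun x y z => by simpa [sup_comm] using abs_sup_sub_sup_le_abs x y z)
    (fun _ hx _ hy => S.sup_mem hx hy) hx hy
  infClosed' := fun _ hx _ hy => map₂_mem_uniformClosure (· ⊓ ·)
    (fun x y z => abs_inf_sub_inf_le_abs x y z)
    (fun x y z => by simpa [inf_comm] using abs_inf_sub_inf_le_abs x y z)
    (fun _ hx _ hy => S.inf_mem hx hy) hx hy

@[simp]
theorem coe_uniformClosure (S : VectorSublattice X) :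
    (S.uniformClosure : Set X) = VectorLattice.uniformClosure (S : Set X) :=
  rfl

end Closure

end VectorSublattice

/-! ### The order (Dedekind) completion -/

/-- The Dedekind completion of a lattice (without added top and bottom elements): the Dedekind cuts
whose two sides are nonempty. -/
def DedekindCompletion (X : Type u) [Lattice X] : Type u :=
  {A : DedekindCut X // A.left.Nonempty ∧ A.right.Nonempty}

namespace DedekindCompletion

section Order

variable {X : Type u} [Lattice X]

/-- The lower side of a cut. -/
def left (A : DedekindCompletion X) : Set X := A.1.left

/-- The upper side of a cut. -/
def right (A : DedekindCompletion X) : Set X := A.1.right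

theorem left_nonempty (A : DedekindCompletion X) : A.left.Nonempty := A.2.1

theorem right_nonempty (A : DedekindCompletion X) : A.right.Nonempty := A.2.2

theorem mem_left_iff {A : DedekindCompletion X} {x : X} : x ∈ A.left ↔ ∀ b ∈ A.right, x ≤ b := by
  unfold left right
  rw [← DedekindCut.lowerBounds_right]
  rfl

theorem mem_right_iff {A : DedekindCompletion X} {x : X} :
    x ∈ A.right ↔ ∀ a ∈ A.left, a ≤ x := by
  unfold left right
  rw [← DedekindCut.upperBounds_left]
  rfl

theorem ext_right {A B : DedekindCompletion X} (h : ∀ x, x ∈ A.right ↔ x ∈ B.right) : A = B :=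
  Subtype.ext (DedekindCut.ext' (Set.ext h))

theorem sup_mem_left {A : DedekindCompletion X} {x y : X} (hx : x ∈ A.left) (hy : y ∈ A.left) :
    x ⊔ y ∈ A.left := by
  rw [mem_left_iff] at *
  exact fun b hb => sup_le (hx b hb) (hy b hb)

theorem inf_mem_right {A : DedekindCompletion X} {x y : X} (hx : x ∈ A.right)
    (hy : y ∈ A.right) : x ⊓ y ∈ A.right := by
  rw [mem_right_iff] at *
  exact fun b hb => le_inf (hx b hb) (hy b hb)

/-- The least cut whose lower side contains a given nonempty bounded set. -/
def ofSet (S : Set X) (hS : S.Nonempty) (hb : BddAbove S) : DedekindCompletion X :=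
  ⟨{ extent := lowerBounds (upperBounds S)
     intent := upperBounds S
     upperPolar_extent := 
       Set.Subset.antisymm (fun _ hx _ ha => hx fun _ hb => hb ha) fun _ hx _ ha => ha hx
     lowerPolar_intent := rfl },
    hS.mono fun _ ha _ hb => hb ha, hb⟩

theorem mem_right_ofSet {S : Set X} {hS : S.Nonempty} {hb : BddAbove S} {x : X} :
    x ∈ (ofSet S hS hb).right ↔ ∀ a ∈ S, a ≤ x :=
  Iff.rfl

/-- The order is inclusion of the lower sides; `⊔` and `⊓` are those of Dedekind cuts. -/
instance : Lattice (DedekindCompletion X) :=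
  Subtype.lattice
    (by
      rintro A B ⟨hA, hA'⟩ ⟨hB, hB'⟩
      obtain ⟨a, ha⟩ := hA
      obtain ⟨x, hx⟩ := hA'
      obtain ⟨y, hy⟩ := hB'
      rw [← DedekindCut.principal_le_iff] at ha
      rw [← DedekindCut.le_principal_iff] at hx hy
      refine ⟨⟨a, ?_⟩, ⟨x ⊔ y, ?_⟩⟩
      · exact DedekindCut.principal_le_iff.1 (ha.trans le_sup_left)
      · refine DedekindCut.le_principal_iff.1 (sup_le (hx.trans ?_) (hy.trans ?_)) <;> simp)
    (by
      rintro A B ⟨hA, hA'⟩ ⟨hB, hB'⟩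
      obtain ⟨a, ha⟩ := hA
      obtain ⟨b, hb⟩ := hB
      obtain ⟨x, hx⟩ := hA'
      rw [← DedekindCut.principal_le_iff] at ha hb
      rw [← DedekindCut.le_principal_iff] at hx
      refine ⟨⟨a ⊓ b, ?_⟩, ⟨x, ?_⟩⟩
      · refine DedekindCut.principal_le_iff.1 (le_inf (le_trans ?_ ha) (le_trans ?_ hb)) <;> simp
      · exact DedekindCut.le_principal_iff.1 (inf_le_left.trans hx))

theorem le_iff_left {A B : DedekindCompletion X} : A ≤ B ↔ A.left ⊆ B.left :=
  Iff.rfl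

theorem le_iff_right {A B : DedekindCompletion X} : A ≤ B ↔ B.right ⊆ A.right :=
  Concept.intent_subset_intent_iff.symm

/-- The cut `(Iic x, Ici x)` of an element `x`. -/
def of (x : X) : DedekindCompletion X :=
  ⟨DedekindCut.principal x, ⟨x, le_refl x⟩, ⟨x, le_refl x⟩⟩

theorem mem_left_of {x y : X} : y ∈ (of x).left ↔ y ≤ x := Iff.rfl

theorem mem_right_of {x y : X} : y ∈ (of x).right ↔ x ≤ y := Iff.rfl

theorem of_le_iff {x : X} {A : DedekindCompletion X} : of x ≤ A ↔ x ∈ A.left :=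
  DedekindCut.principal_le_iff

theorem le_of_iff {x : X} {A : DedekindCompletion X} : A ≤ of x ↔ x ∈ A.right :=
  DedekindCut.le_principal_iff

/-- Every cut is the supremum of the elements below it. -/
theorem isLUB_of (A : DedekindCompletion X) : IsLUB (of '' A.left) A := by
  constructor
  · rintro _ ⟨x, hx, rfl⟩
    exact of_le_iff.2 hx
  · intro B hB
    rw [le_iff_left]
    exact fun x hx => of_le_iff.1 (hB ⟨x, hx, rfl⟩)

/-- The completion is order complete. -/
theorem exists_isLUB (𝒮 : Set (DedekindCompletion X)) (hS : 𝒮.Nonempty) (hb : BddAbove 𝒮) :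
    ∃ A, IsLUB 𝒮 A := by
  obtain ⟨A₀, hA₀⟩ := hS
  obtain ⟨B, hB⟩ := hb
  obtain ⟨a, ha⟩ := A₀.left_nonempty
  obtain ⟨b, hb⟩ := B.right_nonempty
  refine ⟨ofSet (⋃ A ∈ 𝒮, A.left) ⟨a, by simpa using ⟨A₀, hA₀, ha⟩⟩ ⟨b, ?_⟩, ?_, ?_⟩
  · intro x hx
    simp only [Set.mem_iUnion] at hx
    obtain ⟨A, hA, hx⟩ := hx
    exact mem_right_iff.1 hb x (le_iff_left.1 (hB hA) hx)
  · intro A hA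
    rw [le_iff_right]
    intro x hx
    rw [mem_right_iff]
    exact fun y hy => mem_right_ofSet.1 hx y (by simpa using ⟨A, hA, hy⟩)
  · intro C hC
    rw [le_iff_right]
    intro x hx
    refine mem_right_ofSet.2 fun y hy => ?_
    simp only [Set.mem_iUnion] at hy
    obtain ⟨A, hA, hy⟩ := hy
    exact mem_right_iff.1 hx y (le_iff_left.1 (hC hA) hy)

theorem of_injective : Function.Injective (of : X → DedekindCompletion X) := fun _ _ h =>
  DedekindCut.principal_inj.1 (congrArg Subtype.val h)

theorem of_sup (x y : X) : of (x ⊔ y) = of x ⊔ of y := by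
  apply le_antisymm
  · rw [le_iff_right]
    intro z hz
    rw [← le_of_iff, sup_le_iff, le_of_iff, le_of_iff] at hz
    exact sup_le (mem_right_of.1 hz.1) (mem_right_of.1 hz.2)
  · exact sup_le (of_le_iff.2 (mem_left_of.2 le_sup_left))
      (of_le_iff.2 (mem_left_of.2 le_sup_right))

theorem of_inf (x y : X) : of (x ⊓ y) = of x ⊓ of y := by
  apply le_antisymm
  · exact le_inf (of_le_iff.2 (mem_left_of.2 inf_le_left))
      (of_le_iff.2 (mem_left_of.2 inf_le_right))
  · rw [le_iff_left]
    intro z hz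
    rw [← of_le_iff, le_inf_iff, of_le_iff, of_le_iff] at hz
    exact le_inf (mem_left_of.1 hz.1) (mem_left_of.1 hz.2)

end Order

section Group

variable {X : Type u} [AddCommGroup X] [Lattice X] [IsOrderedAddMonoid X]

instance : Zero (DedekindCompletion X) := ⟨of 0⟩

/-- `A + B` is the cut generated by all `a + b` with `a`, `b` in the lower sides. -/
instance : Add (DedekindCompletion X) where
  add A B := ofSet {x | ∃ a ∈ A.left, ∃ b ∈ B.left, a + b = x}
    (by
      obtain ⟨a, ha⟩ := A.left_nonempty
      obtain ⟨b, hb⟩ := B.left_nonempty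
      exact ⟨_, a, ha, b, hb, rfl⟩)
    (by
      obtain ⟨a, ha⟩ := A.right_nonempty
      obtain ⟨b, hb⟩ := B.right_nonempty
      refine ⟨a + b, ?_⟩
      rintro _ ⟨x, hx, y, hy, rfl⟩
      exact add_le_add (mem_right_iff.1 ha x hx) (mem_right_iff.1 hb y hy))

/-- `-A` is the cut generated by all `-b` with `b` in the upper side. -/
instance : Neg (DedekindCompletion X) where
  neg A := ofSet {x | -x ∈ A.right}
    (by
      obtain ⟨a, ha⟩ := A.right_nonempty
      exact ⟨-a, by simpa using ha⟩)
    (by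
      obtain ⟨a, ha⟩ := A.left_nonempty
      refine ⟨-a, fun x hx => ?_⟩
      exact le_neg.1 (mem_right_iff.1 hx a ha))

theorem mem_right_zero {x : X} : x ∈ (0 : DedekindCompletion X).right ↔ 0 ≤ x := Iff.rfl

theorem mem_right_add {A B : DedekindCompletion X} {x : X} :
    x ∈ (A + B).right ↔ ∀ a ∈ A.left, ∀ b ∈ B.left, a + b ≤ x := by
  refine mem_right_ofSet.trans ⟨fun h a ha b hb => h _ ⟨a, ha, b, hb, rfl⟩, ?_⟩
  rintro h _ ⟨a, ha, b, hb, rfl⟩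
  exact h a ha b hb

theorem mem_right_add_iff_right {A B : DedekindCompletion X} {x : X} :
    x ∈ (A + B).right ↔ ∀ b ∈ B.left, x - b ∈ A.right := by
  rw [mem_right_add]
  simp only [mem_right_iff (A := A), le_sub_iff_add_le]
  exact ⟨fun h b hb a ha => h a ha b hb, fun h a ha b hb => h b hb a ha⟩

theorem mem_right_neg {A : DedekindCompletion X} {x : X} : x ∈ (-A).right ↔ -x ∈ A.left := by
  rw [mem_left_iff]
  refine mem_right_ofSet.trans ⟨fun h b hb => ?_, fun h a ha => ?_⟩
  · exact neg_le.1 (h (-b) (by simpa using hb))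
  · exact neg_le_neg_iff.1 (h (-a) ha)

theorem mem_left_neg {A : DedekindCompletion X} {x : X} : x ∈ (-A).left ↔ -x ∈ A.right := by
  rw [mem_left_iff, mem_right_iff]
  refine ⟨fun h a ha => ?_, fun h b hb => ?_⟩
  · exact le_neg.1 (h (-a) (mem_right_neg.2 (by simpa using ha)))
  · exact neg_le_neg_iff.1 (h (-b) (mem_right_neg.1 hb))

theorem add_comm' (A B : DedekindCompletion X) : A + B = B + A := by
  apply ext_right
  intro x
  rw [mem_right_add, mem_right_add]
  exact ⟨fun h a ha b hb => add_comm b a ▸ h b hb a ha, fun h a ha b hb => add_comm b a ▸ h b hb a ha⟩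

theorem mem_right_add_add {A B C : DedekindCompletion X} {x : X} :
    x ∈ (A + B + C).right ↔ ∀ a ∈ A.left, ∀ b ∈ B.left, ∀ c ∈ C.left, a + b + c ≤ x := by
  rw [mem_right_add_iff_right]
  simp only [mem_right_add, le_sub_iff_add_le]
  exact ⟨fun h a ha b hb c hc => h c hc a ha b hb, fun h c hc a ha b hb => h a ha b hb c hc⟩

instance [IsArchimedean X] : AddCommGroup (DedekindCompletion X) where
  add_assoc A B C := by
    apply ext_right
    intro x
    rw [add_comm' A (B + C), mem_right_add_add, mem_right_add_add]
    refine ⟨fun h b hb c hc a ha => ?_, fun h a ha b hb c hc => ?_⟩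
    · rw [add_comm (b + c) a, ← add_assoc]; exact h a ha b hb c hc
    · rw [add_assoc, add_comm a (b + c)]; exact h b hb c hc a ha
  zero_add A := by
    apply ext_right
    intro x
    rw [mem_right_add, mem_right_iff]
    refine ⟨fun h a ha => by simpa using h 0 le_rfl a ha, fun h b hb a ha => ?_⟩
    have hb : b ≤ 0 := hb
    simpa using add_le_add hb (h a ha)
  add_zero A := by
    rw [add_comm']
    apply ext_right
    intro x
    rw [mem_right_add, mem_right_iff]
    refine ⟨fun h a ha => by simpa using h 0 le_rfl a ha, fun h b hb a ha => ?_⟩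
    have hb : b ≤ 0 := hb
    simpa using add_le_add hb (h a ha)
  add_comm := add_comm'
  nsmul := nsmulRec
  zsmul := zsmulRec
  neg_add_cancel A := by
    apply ext_right
    intro x
    rw [mem_right_add, mem_right_zero]
    constructor
    · intro h
      -- adding `-x` repeatedly to an element of the lower side stays in the lower side
      have key : ∀ a ∈ A.left, a - x ∈ A.left := by
        intro a ha
        rw [mem_left_iff]
        intro b hb
        have := h (-b) (mem_left_neg.2 (by simpa using hb)) a ha
        rw [sub_le_iff_le_add]
        rwa [neg_add_le_iff_le_add] at this
      obtain ⟨a, ha⟩ := A.left_nonempty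
      obtain ⟨b, hb⟩ := A.right_nonempty
      have hn : ∀ n : ℕ, a + n • (-x) ∈ A.left := by
        intro n
        induction n with
        | zero => simpa using ha
        | succ n ih =>
          rw [succ_nsmul, ← add_assoc, ← sub_eq_add_neg]
          exact key _ ih
      have := IsArchimedean.le_zero_of_forall_nsmul_le (-x) (b - a) fun n =>
        le_sub_iff_add_le'.2 (mem_right_iff.1 hb _ (hn n))
      exact neg_nonpos.1 this
    · intro hx b hb a ha
      have := mem_right_iff.1 (mem_left_neg.1 hb) a ha
      exact (le_neg_iff_add_nonpos_left.1 this).trans hx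

instance [IsArchimedean X] : IsOrderedAddMonoid (DedekindCompletion X) where
  add_le_add_left A B h C := by
    rw [le_iff_right]
    intro x hx
    rw [mem_right_add] at *
    exact fun a ha c hc => hx a (le_iff_left.1 h ha) c hc

theorem of_add (x y : X) : of (x + y) = of x + of y := by
  apply ext_right
  intro z
  rw [mem_right_of, mem_right_add]
  exact ⟨fun h a ha b hb => (add_le_add ha hb).trans h, fun h => h x le_rfl y le_rfl⟩

end Group

section Module

variable {X : Type u} [AddCommGroup X] [Lattice X] [IsOrderedAddMonoid X]
  [Module ℝ X] [IsOrderedModule ℝ X]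

/-- Multiplication by a scalar `r ≥ 0`: the cut generated by all `r a` with `a` in the lower
side. -/
def posSMul (r : ℝ) (hr : 0 ≤ r) (A : DedekindCompletion X) : DedekindCompletion X :=
  ofSet ((r • ·) '' A.left) (A.left_nonempty.image _)
    (by
      obtain ⟨b, hb⟩ := A.right_nonempty
      refine ⟨r • b, ?_⟩
      rintro _ ⟨a, ha, rfl⟩
      exact smul_le_smul_of_nonneg_left (mem_right_iff.1 hb a ha) hr)

theorem mem_right_posSMul {r : ℝ} {hr : 0 ≤ r} {A : DedekindCompletion X} {x : X} :
    x ∈ (posSMul r hr A).right ↔ ∀ a ∈ A.left, r • a ≤ x := by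
  rw [posSMul, mem_right_ofSet, Set.forall_mem_image]

theorem posSMul_add_posSMul (r s : ℝ) (hr : 0 ≤ r) (hs : 0 ≤ s) (A : DedekindCompletion X) :
    posSMul (r + s) (add_nonneg hr hs) A = posSMul r hr A + posSMul s hs A := by
  apply ext_right
  intro x
  rw [mem_right_add_iff_right]
  simp only [mem_right_posSMul, le_sub_iff_add_le]
  constructor
  · intro h b hb a ha
    rw [← le_sub_iff_add_le']
    refine mem_left_iff.1 hb _ (mem_right_posSMul.2 fun a' ha' => ?_)
    rw [le_sub_iff_add_le']
    refine le_trans ?_ (h _ (sup_mem_left ha ha'))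
    rw [add_smul]
    exact add_le_add (smul_le_smul_of_nonneg_left le_sup_left hr)
      (smul_le_smul_of_nonneg_left le_sup_right hs)
  · intro h a ha
    rw [add_smul]
    exact h _ (mem_left_iff.2 fun b hb => mem_right_posSMul.1 hb a ha) a ha

theorem posSMul_add (r : ℝ) (hr : 0 ≤ r) (A B : DedekindCompletion X) :
    posSMul r hr (A + B) = posSMul r hr A + posSMul r hr B := by
  apply ext_right
  intro x
  have h1 : x ∈ (posSMul r hr A + posSMul r hr B).right ↔
      ∀ a ∈ A.left, ∀ b ∈ B.left, r • a + r • b ≤ x := by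
    rw [mem_right_add_iff_right]
    simp only [mem_right_posSMul, le_sub_iff_add_le]
    constructor
    · exact fun h a ha b hb =>
        h _ (mem_left_iff.2 fun c hc => mem_right_posSMul.1 hc b hb) a ha
    · intro h b hb a ha
      rw [← le_sub_iff_add_le']
      refine mem_left_iff.1 hb _ (mem_right_posSMul.2 fun b' hb' => ?_)
      rw [le_sub_iff_add_le']
      exact h a ha b' hb'
  rw [h1, mem_right_posSMul]
  constructor
  · intro h a ha b hb
    rw [← smul_add]
    exact h _ (mem_left_iff.2 fun c hc => mem_right_add.1 hc a ha b hb)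
  · intro h c hc
    rcases hr.eq_or_lt with rfl | hr'
    · obtain ⟨a, ha⟩ := A.left_nonempty
      obtain ⟨b, hb⟩ := B.left_nonempty
      simpa using h a ha b hb
    · rw [← le_inv_smul_iff_of_pos hr']
      refine mem_left_iff.1 hc _ (mem_right_add.2 fun a ha b hb => ?_)
      rw [le_inv_smul_iff_of_pos hr', smul_add]
      exact h a ha b hb

theorem posSMul_posSMul (r s : ℝ) (hr : 0 ≤ r) (hs : 0 ≤ s) (A : DedekindCompletion X) :
    posSMul r hr (posSMul s hs A) = posSMul (r * s) (mul_nonneg hr hs) A := by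
  apply ext_right
  intro x
  rw [mem_right_posSMul, mem_right_posSMul]
  constructor
  · intro h a ha
    rw [mul_smul]
    exact h _ (mem_left_iff.2 fun c hc => mem_right_posSMul.1 hc a ha)
  · intro h c hc
    rcases hr.eq_or_lt with rfl | hr'
    · obtain ⟨a, ha⟩ := A.left_nonempty
      simpa using h a ha
    · rw [← le_inv_smul_iff_of_pos hr']
      refine mem_left_iff.1 hc _ (mem_right_posSMul.2 fun a ha => ?_)
      rw [le_inv_smul_iff_of_pos hr', ← mul_smul]
      exact h a ha

theorem posSMul_one (A : DedekindCompletion X) : posSMul 1 zero_le_one A = A := by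
  apply ext_right
  intro x
  rw [mem_right_posSMul, mem_right_iff]
  simp

theorem posSMul_of (r : ℝ) (hr : 0 ≤ r) (x : X) : posSMul r hr (of x) = of (r • x) := by
  apply ext_right
  intro z
  rw [mem_right_posSMul, mem_right_of]
  exact ⟨fun h => h x le_rfl, fun h a ha => (smul_le_smul_of_nonneg_left ha hr).trans h⟩

variable [IsArchimedean X]

/-- Scalar multiplication: `r A = r⁺ A - r⁻ A`. -/
instance : SMul ℝ (DedekindCompletion X) where
  smul r A := posSMul r⁺ (posPart_nonneg r) A - posSMul r⁻ (negPart_nonneg r) A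

theorem smul_eq {r p q : ℝ} (hp : 0 ≤ p) (hq : 0 ≤ q) (h : r = p - q)
    (A : DedekindCompletion X) : r • A = posSMul p hp A - posSMul q hq A := by
  change posSMul r⁺ (posPart_nonneg r) A - posSMul r⁻ (negPart_nonneg r) A = _
  rw [sub_eq_sub_iff_add_eq_add, ← posSMul_add_posSMul, ← posSMul_add_posSMul]
  congr 1
  have := posPart_sub_negPart r
  linarith

theorem posSMul_zero_left (A : DedekindCompletion X) : posSMul 0 le_rfl A = 0 := by
  have := posSMul_add_posSMul 0 0 le_rfl le_rfl A
  simpa using this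

theorem smul_of_nonneg {r : ℝ} (hr : 0 ≤ r) (A : DedekindCompletion X) :
    r • A = posSMul r hr A := by
  rw [smul_eq hr le_rfl (sub_zero r).symm, posSMul_zero_left, sub_zero]

theorem posSMul_sub (r : ℝ) (hr : 0 ≤ r) (A B : DedekindCompletion X) :
    posSMul r hr (A - B) = posSMul r hr A - posSMul r hr B := by
  rw [eq_sub_iff_add_eq, ← posSMul_add, sub_add_cancel]

instance : Module ℝ (DedekindCompletion X) where
  one_smul A := by rw [smul_of_nonneg zero_le_one, posSMul_one]
  mul_smul r s A := by
    have hr := (posPart_sub_negPart r).symm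
    have hs := (posPart_sub_negPart s).symm
    have pr := posPart_nonneg r
    have nr := negPart_nonneg r
    have ps := posPart_nonneg s
    have ns := negPart_nonneg s
    rw [smul_eq ps ns hs, smul_eq pr nr hr, posSMul_sub, posSMul_sub, posSMul_posSMul,
      posSMul_posSMul, posSMul_posSMul, posSMul_posSMul,
      smul_eq (p := r⁺ * s⁺ + r⁻ * s⁻) (q := r⁺ * s⁻ + r⁻ * s⁺) (by positivity) (by positivity),
      posSMul_add_posSMul _ _ (by positivity) (by positivity),
      posSMul_add_posSMul _ _ (by positivity) (by positivity)]
    · abel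
    · conv_lhs => rw [hr, hs]
      ring
  smul_zero r := by
    have h : ∀ p (hp : 0 ≤ p), posSMul p hp (0 : DedekindCompletion X) = 0 := fun p hp => by
      have := posSMul_add p hp (0 : DedekindCompletion X) 0
      simpa using this
    rw [smul_eq (posPart_nonneg r) (negPart_nonneg r) (posPart_sub_negPart r).symm, h, h, sub_zero]
  smul_add r A B := by
    have hr := (posPart_sub_negPart r).symm
    have pr := posPart_nonneg r
    have nr := negPart_nonneg r
    rw [smul_eq pr nr hr, smul_eq pr nr hr, smul_eq pr nr hr, posSMul_add, posSMul_add]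
    abel
  add_smul r s A := by
    have hr := (posPart_sub_negPart r).symm
    have hs := (posPart_sub_negPart s).symm
    have pr := posPart_nonneg r
    have nr := negPart_nonneg r
    have ps := posPart_nonneg s
    have ns := negPart_nonneg s
    rw [smul_eq pr nr hr, smul_eq ps ns hs,
      smul_eq (add_nonneg pr ps) (add_nonneg nr ns) (r := r + s), posSMul_add_posSMul _ _ pr ps,
      posSMul_add_posSMul _ _ nr ns]
    · abel
    · conv_lhs => rw [hr, hs]
      ring
  zero_smul A := by rw [smul_of_nonneg le_rfl, posSMul_zero_left]

theorem posSMul_nonneg (r : ℝ) (hr : 0 ≤ r) {A : DedekindCompletion X} (hA : 0 ≤ A) :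
    0 ≤ posSMul r hr A := by
  rw [le_iff_right]
  intro x hx
  rw [mem_right_posSMul] at hx
  rw [mem_right_zero]
  simpa using hx 0 (of_le_iff.1 hA)

instance : IsOrderedModule ℝ (DedekindCompletion X) where
  smul_le_smul_of_nonneg_left r hr A B h := by
    rw [← sub_nonneg, ← smul_sub, smul_of_nonneg hr]
    exact posSMul_nonneg r hr (sub_nonneg.2 h)
  smul_le_smul_of_nonneg_right A hA r s h := by
    rw [← sub_nonneg, ← sub_smul, smul_of_nonneg (sub_nonneg.2 h)]
    exact posSMul_nonneg _ _ hA

instance : IsArchimedean (DedekindCompletion X) where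
  le_zero_of_forall_nsmul_le A B h := by
    obtain ⟨b, hb⟩ := B.right_nonempty
    rw [le_iff_left]
    intro x hx
    refine IsArchimedean.le_zero_of_forall_nsmul_le x b fun n => ?_
    have h1 : of (n • x) = n • of x := by
      induction n with
      | zero => simp; rfl
      | succ n ih => rw [succ_nsmul, succ_nsmul, of_add, ih]
    have h2 : n • of x ≤ n • A := nsmul_le_nsmul_right (of_le_iff.2 hx) n
    exact mem_left_of.1 (of_le_iff.1 (h1 ▸ h2.trans ((h n).trans (le_of_iff.2 hb))))

variable (X) in
/-- The canonical embedding of `X` into its Dedekind completion, as a linear map. It is injective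
and preserves `⊔` and `⊓`. -/
def embed : X →ₗ[ℝ] DedekindCompletion X where
  toFun := of
  map_add' := of_add
  map_smul' r x := by
    rw [RingHom.id_apply, smul_eq (posPart_nonneg r) (negPart_nonneg r)
      (posPart_sub_negPart r).symm, posSMul_of, posSMul_of, eq_sub_iff_add_eq, ← of_add,
      ← add_smul]
    congr 2
    have := posPart_sub_negPart r
    linarith

@[simp]
theorem embed_apply (x : X) : embed X x = of x := rfl

end Module

end DedekindCompletion

/-! ### The uniform completion -/

section Completion

variable (X : Type u) [AddCommGroup X] [Lattice X] [IsOrderedAddMonoid X]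
  [Module ℝ X] [IsOrderedModule ℝ X] [IsArchimedean X]

/-- The uniform completion of `X`: the intersection of all uniformly complete sublattices of the
Dedekind completion of `X` that contain `X`. -/
def uniformCompletion : VectorSublattice (DedekindCompletion X) :=
  sInf {S | UniformlyComplete S ∧ ∀ x : X, DedekindCompletion.embed X x ∈ S}

variable {X} in
/-- An element of `X`, seen as an element of the uniform completion. -/
def toUniformCompletion (x : X) : uniformCompletion X :=
  ⟨DedekindCompletion.embed X x, fun _ hS => hS.2 x⟩

end Completion

end VectorLattice

namespace VectorLattice

/-! ### Uniform convergence relative to a fixed regulator -/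

section Basic

variable {A B : Type u} [AddCommGroup A] [Lattice A] [IsOrderedAddMonoid A]
  [Module ℝ A] [IsOrderedModule ℝ A]
  [AddCommGroup B] [Lattice B] [IsOrderedAddMonoid B] [Module ℝ B] [IsOrderedModule ℝ B]

/-! Let `i : X → A` and `j : X → B` be embeddings of `X` as a majorizing sublattice of two uniformly
complete Archimedean vector lattices. The isomorphism between the uniform closures of the two copies
of `X` is obtained from its graph: take the uniform closure `G` of the diagonal `{(i x, j x)}` in `A
× B`. As the closure of a sublattice, `G` is a sublattice, so whatever map it defines is
automatically linear and preserves `⊔` and `⊓`.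

The crux is `isGLB_of_mem_closedGraph`: if `(a, b) ∈ G`, then `b = inf {j x : a ≤ i x}`. This
property holds on the diagonal and survives uniform limits, because majorization allows the
regulator to be taken in `X`. Hence `a` determines `b`, and by symmetry `b` determines `a`. The same
property transfers the bound `|a| ≤ i u` to `|b| ≤ j u`, so Cauchy nets of first components have
Cauchy nets of second components. Completeness of `B` then makes the domain of `G` the whole closure
of `i X` (`exists_mem_closedGraph`).

It remains to see that `X^ru` is the uniform closure of `X` in `X^δ` (`coe_uniformCompletion`). A
sublattice of `X^δ` containing `X` is majorizing, and for such sublattices uniform completeness and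
uniform closedness coincide, since `X^δ` is itself uniformly complete. The theorem follows with `A =
X^δ` and `B = Y`. -/

/-- Taking `ε = 1/n` bounds every multiple `n • (a - b)` by `|e|`. Every passage to a limit in an
inequality below rests on this form of the Archimedean property. -/
theorem le_of_forall_le_add_smul [IsArchimedean A] {a b e : A}
    (h : ∀ ε : ℝ, 0 < ε → a ≤ b + ε • e) : a ≤ b := by
  have he : ∀ n : ℕ, n • (a - b) ≤ |e| := by
    intro n
    rcases n.eq_zero_or_pos with rfl | hn
    · simp
    · have hn' : (0 : ℝ) < n := by exact_mod_cast hn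
      have h1 : a - b ≤ (n : ℝ)⁻¹ • e := sub_le_iff_le_add'.2 (h _ (inv_pos.2 hn'))
      rw [← Nat.cast_smul_eq_nsmul ℝ]
      calc (n : ℝ) • (a - b) ≤ (n : ℝ) • (n : ℝ)⁻¹ • e :=
            smul_le_smul_of_nonneg_left h1 hn'.le
        _ = e := smul_inv_smul₀ hn'.ne' e
        _ ≤ |e| := le_abs_self e
  exact sub_nonpos.1 (IsArchimedean.le_zero_of_forall_nsmul_le _ _ he)

theorem abs_sub_le_iff' {a b c : A} : |a - b| ≤ c ↔ a ≤ b + c ∧ b ≤ a + c := by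
  rw [abs_le', neg_sub, sub_le_iff_le_add', sub_le_iff_le_add']

theorem ConvergesRel.mono {ι : Type*} [Preorder ι] {e e' : A} (h : e ≤ e') {f : ι → A} {x : A}
    (hf : ConvergesRel e f x) : ConvergesRel e' f x := fun ε hε => by
  obtain ⟨i₀, hi₀⟩ := hf ε hε
  exact ⟨i₀, fun i hi => (hi₀ i hi).trans (smul_le_smul_of_nonneg_left h hε.le)⟩

theorem ConvergesRel.unique [IsArchimedean A] {ι : Type*} [Preorder ι] [IsDirectedOrder ι]
    {e : A} {f : ι → A} {x y : A} (hx : ConvergesRel e f x) (hy : ConvergesRel e f y) : x = y := by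
  have key : ∀ {x y : A}, ConvergesRel e f x → ConvergesRel e f y → x ≤ y := by
    intro x y hx hy
    refine le_of_forall_le_add_smul (e := (2 : ℝ) • e) fun ε hε => ?_
    obtain ⟨i, hi⟩ := hx ε hε
    obtain ⟨j, hj⟩ := hy ε hε
    obtain ⟨k, hik, hjk⟩ := exists_ge_ge i j
    refine (abs_sub_le_iff'.1 (hi k hik)).2.trans ?_
    refine (add_le_add_left (abs_sub_le_iff'.1 (hj k hjk)).1 _).trans_eq ?_
    module
  exact le_antisymm (key hx hy) (key hy hx)

/-- A net is Cauchy relative to the regulator `e` if its tails have differences below any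
multiple of `e`. -/
def IsCauchyRel {ι : Type*} [Preorder ι] (e : A) (f : ι → A) : Prop :=
  ∀ ε : ℝ, 0 < ε → ∃ i₀, ∀ i, i₀ ≤ i → ∀ j, i₀ ≤ j → |f i - f j| ≤ ε • e

/-- By directedness, every tail of `ι × ι` contains the square of a tail of `ι`. -/
theorem isCauchyNet_iff {ι : Type*} [Preorder ι] [IsDirectedOrder ι] {f : ι → A} :
    IsCauchyNet f ↔ ∃ e, 0 ≤ e ∧ IsCauchyRel e f := by
  refine exists_congr fun e => and_congr_right fun _ => forall₂_congr fun ε _ => ?_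
  constructor
  · rintro ⟨⟨i, j⟩, h⟩
    obtain ⟨k, hik, hjk⟩ := exists_ge_ge i j
    exact ⟨k, fun a ha b hb => by simpa using h (a, b) ⟨hik.trans ha, hjk.trans hb⟩⟩
  · rintro ⟨i, h⟩
    exact ⟨(i, i), fun p hp => by simpa using h p.1 hp.1 p.2 hp.2⟩

theorem ConvergesRel.isCauchyRel {ι : Type*} [Preorder ι] {e : A} {f : ι → A} {x : A}
    (hf : ConvergesRel e f x) : IsCauchyRel e f := fun ε hε => by
  obtain ⟨i₀, hi₀⟩ := hf (ε / 2) (half_pos hε)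
  refine ⟨i₀, fun i hi j hj => ?_⟩
  have h1 := abs_sub_le_iff'.1 (hi₀ i hi)
  have h2 := abs_sub_le_iff'.1 (hi₀ j hj)
  have h3 : ∀ z : A, z + (ε / 2) • e + (ε / 2) • e = z + ε • e := fun z => by module
  exact abs_sub_le_iff'.2 ⟨(h1.1.trans (add_le_add_left h2.2 _)).trans_eq (h3 _),
    (h2.1.trans (add_le_add_left h1.2 _)).trans_eq (h3 _)⟩

/-- Let `k` grow in `|f i - f k| ≤ ε • e`: the error `δ • e'` from the unknown regulator `e'` of the
limit vanishes by the Archimedean property. A limit can therefore always be taken relative to the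
regulator of the Cauchy condition. -/
theorem IsCauchyRel.convergesRel [IsArchimedean A] {ι : Type*} [Preorder ι] [IsDirectedOrder ι]
    {e : A} {f : ι → A} {x : A} (hf : IsCauchyRel e f) (hx : Converges f x) :
    ConvergesRel e f x := by
  obtain ⟨e', -, hx⟩ := hx
  intro ε hε
  obtain ⟨i₀, hi₀⟩ := hf ε hε
  refine ⟨i₀, fun i hi => ?_⟩
  refine le_of_forall_le_add_smul (e := e') fun δ hδ => ?_
  obtain ⟨j, hj⟩ := hx δ hδ
  obtain ⟨k, hk, hjk⟩ := exists_ge_ge i₀ j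
  have := add_le_add (hi₀ i hi k hk) (hj k hjk)
  refine le_trans ?_ this
  simpa using abs_add_le (f i - f k) (f k - x)

theorem IsUniformlyClosed.preimage {s : Set B} (hs : IsUniformlyClosed s) (φ : A → B)
    (hφ : ∀ (ι : Type u) [Preorder ι] (f : ι → A) (x : A),
      Converges f x → Converges (fun i => φ (f i)) (φ x)) : IsUniformlyClosed (φ ⁻¹' s) :=
  fun ι _ _ _ f x hf h => hs ι _ _ hf (hφ ι f x h)

instance : IsOrderedModule ℝ (A × B) where
  smul_le_smul_of_nonneg_left _ hr _ _ h :=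
    ⟨smul_le_smul_of_nonneg_left h.1 hr, smul_le_smul_of_nonneg_left h.2 hr⟩
  smul_le_smul_of_nonneg_right _ hb _ _ h :=
    ⟨smul_le_smul_of_nonneg_right h hb.1, smul_le_smul_of_nonneg_right h hb.2⟩

theorem convergesRel_prod {ι : Type*} [Preorder ι] [IsDirectedOrder ι] {e : A × B}
    {f : ι → A × B} {x : A × B} : ConvergesRel e f x ↔
      ConvergesRel e.1 (fun i => (f i).1) x.1 ∧ ConvergesRel e.2 (fun i => (f i).2) x.2 := by
  constructor
  · intro h
    refine ⟨fun ε hε => ?_, fun ε hε => ?_⟩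
    · obtain ⟨i₀, hi₀⟩ := h ε hε
      exact ⟨i₀, fun i hi => (hi₀ i hi).1⟩
    · obtain ⟨i₀, hi₀⟩ := h ε hε
      exact ⟨i₀, fun i hi => (hi₀ i hi).2⟩
  · rintro ⟨h1, h2⟩ ε hε
    obtain ⟨i, hi⟩ := h1 ε hε
    obtain ⟨j, hj⟩ := h2 ε hε
    obtain ⟨k, hik, hjk⟩ := exists_ge_ge i j
    exact ⟨k, fun l hl => ⟨hi l (hik.trans hl), hj l (hjk.trans hl)⟩⟩

end Basic

/-! ### Majorizing embeddings -/

section Embedding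

variable {X A B : Type u}
  [AddCommGroup X] [Lattice X] [IsOrderedAddMonoid X] [Module ℝ X] [IsOrderedModule ℝ X]
  [AddCommGroup A] [Lattice A] [IsOrderedAddMonoid A] [Module ℝ A] [IsOrderedModule ℝ A]
  [AddCommGroup B] [Lattice B] [IsOrderedAddMonoid B] [Module ℝ B] [IsOrderedModule ℝ B]

/-- An embedding of vector lattices whose range is majorizing. -/
structure IsMajorizingEmbedding (i : X →ₗ[ℝ] A) : Prop where
  map_sup : ∀ x y, i (x ⊔ y) = i x ⊔ i y
  map_inf : ∀ x y, i (x ⊓ y) = i x ⊓ i y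
  le_iff : ∀ {x y}, i x ≤ i y ↔ x ≤ y
  exists_le : ∀ a, ∃ x, a ≤ i x

variable {i : X →ₗ[ℝ] A} {j : X →ₗ[ℝ] B}

/-- The set of pairs `(i x, j x)` as a sublattice of the product. -/
def diagonal (hi : IsMajorizingEmbedding i) (hj : IsMajorizingEmbedding j) :
    VectorSublattice (A × B) where
  toSubmodule := LinearMap.range (i.prod j)
  supClosed' := by
    rintro _ ⟨x, rfl⟩ _ ⟨y, rfl⟩
    exact ⟨x ⊔ y, Prod.ext (hi.map_sup x y) (hj.map_sup x y)⟩
  infClosed' := by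
    rintro _ ⟨x, rfl⟩ _ ⟨y, rfl⟩
    exact ⟨x ⊓ y, Prod.ext (hi.map_inf x y) (hj.map_inf x y)⟩

/-- The uniform closure of the set of pairs `(i x, j x)`. -/
def closedGraph (hi : IsMajorizingEmbedding i) (hj : IsMajorizingEmbedding j) :
    VectorSublattice (A × B) :=
  (diagonal hi hj).uniformClosure

variable (hi : IsMajorizingEmbedding i) (hj : IsMajorizingEmbedding j)

/-! ### The closed graph is the graph of an isomorphism -/

theorem isUniformlyClosed_closedGraph :
    IsUniformlyClosed (closedGraph hi hj : Set (A × B)) :=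
  isUniformlyClosed_uniformClosure _

theorem map_mem_closedGraph (x : X) : (i x, j x) ∈ closedGraph hi hj :=
  subset_uniformClosure _ ⟨x, rfl⟩

theorem closedGraph_subset {s : Set (A × B)} (hs : IsUniformlyClosed s)
    (h : ∀ x, (i x, j x) ∈ s) : (closedGraph hi hj : Set (A × B)) ⊆ s :=
  uniformClosure_subset hs (by rintro _ ⟨x, rfl⟩; exact h x)

/-- This symmetry turns each statement about one component into the statement about the other. -/
theorem swap_mem_closedGraph {p : A × B} (hp : p ∈ closedGraph hi hj) :
    p.swap ∈ closedGraph hj hi := by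
  refine closedGraph_subset hi hj
    ((isUniformlyClosed_closedGraph hj hi).preimage Prod.swap ?_)
    (map_mem_closedGraph hj hi) hp
  rintro ι _ f x ⟨e, he, h⟩
  refine ⟨e.swap, ⟨he.2, he.1⟩, fun ε hε => ?_⟩
  obtain ⟨k, hk⟩ := h ε hε
  exact ⟨k, fun l hl => ⟨(hk l hl).2, (hk l hl).1⟩⟩

include hi hj in
/-- In a pair of the closed graph, the second component is the infimum of the elements of `X`
above the first component. -/
theorem isGLB_of_mem_closedGraph [IsArchimedean B] {p : A × B} (hp : p ∈ closedGraph hi hj) :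
    IsGLB (j '' {x | p.1 ≤ i x}) p.2 := by
  refine closedGraph_subset hi hj (s := {p | IsGLB (j '' {x | p.1 ≤ i x}) p.2}) ?_ ?_ hp
  · rintro ι _ _ _ f ⟨a, b⟩ hf ⟨e, he, h⟩
    -- Enlarge the regulator to an element `(i u, j u)` of the diagonal. An error `ε • u` can then
    -- be added to elements of `X` and read off in both components.
    obtain ⟨x₁, hx₁⟩ := hi.exists_le e.1
    obtain ⟨x₂, hx₂⟩ := hj.exists_le e.2
    set u := x₁ ⊔ x₂ with hu
    have h1 : e ≤ (i u, j u) := ⟨hx₁.trans (hi.le_iff.2 le_sup_left),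
      hx₂.trans (hj.le_iff.2 le_sup_right)⟩
    replace h := h.mono h1
    have h3 : ∀ (z : B) (ε : ℝ), z + ε • j u + ε • j u = z + ε • ((2 : ℝ) • j u) :=
      fun z ε => by module
    constructor
    · rintro _ ⟨x, hx, rfl⟩
      refine le_of_forall_le_add_smul (e := (2 : ℝ) • j u) fun ε hε => ?_
      obtain ⟨k, hk⟩ := h ε hε
      have hA := abs_sub_le_iff'.1 (hk k le_rfl).1
      have hB := abs_sub_le_iff'.1 (hk k le_rfl).2
      -- If `x` lies above the limit `a`, then `x + ε • u` lies above `(f k).1`, so `(f k).2 ≤ j x +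
      -- ε • j u`. Passing from `(f k).2` to `b` costs another `ε • j u`.
      have h2 : (f k).1 ≤ i (x + ε • u) := by
        rw [map_add, map_smul]
        exact hA.1.trans (add_le_add_left hx _)
      have h4 := (hf k).1 ⟨_, h2, rfl⟩
      rw [map_add, map_smul] at h4
      exact (hB.2.trans (add_le_add_left h4 _)).trans_eq (h3 _ _)
    · intro z hz
      refine le_of_forall_le_add_smul (e := (2 : ℝ) • j u) fun ε hε => ?_
      obtain ⟨k, hk⟩ := h ε hε
      have hA := abs_sub_le_iff'.1 (hk k le_rfl).1
      have hB := abs_sub_le_iff'.1 (hk k le_rfl).2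
      -- Conversely, if `x` lies above `(f k).1`, then `x + ε • u` lies above `a`, so the lower
      -- bound `z` satisfies `z ≤ j x + ε • j u`. Now take the infimum over `x`.
      have h2 : z - ε • j u ≤ (f k).2 := by
        refine (hf k).2 ?_
        rintro _ ⟨x, hx, rfl⟩
        rw [sub_le_iff_le_add, ← map_smul, ← map_add]
        refine hz ⟨_, ?_, rfl⟩
        rw [Set.mem_ofPred_eq, map_add, map_smul]
        exact hA.2.trans (add_le_add_left hx _)
      exact ((sub_le_iff_le_add.1 h2).trans (add_le_add_left hB.1 _)).trans_eq (h3 _ _)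
  · intro x
    refine IsLeast.isGLB ⟨⟨x, le_refl (i x), rfl⟩, ?_⟩
    rintro _ ⟨y, hy, rfl⟩
    exact hj.le_iff.2 (hi.le_iff.1 hy)

theorem closedGraph_right_unique [IsArchimedean B] {a : A} {b b' : B}
    (h : (a, b) ∈ closedGraph hi hj) (h' : (a, b') ∈ closedGraph hi hj) : b = b' :=
  (isGLB_of_mem_closedGraph hi hj h).unique (isGLB_of_mem_closedGraph hi hj h')

theorem closedGraph_left_unique [IsArchimedean A] {a a' : A} {b : B}
    (h : (a, b) ∈ closedGraph hi hj) (h' : (a', b) ∈ closedGraph hi hj) : a = a' :=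
  closedGraph_right_unique hj hi (swap_mem_closedGraph hi hj h) (swap_mem_closedGraph hi hj h')

theorem fst_mem_of_mem_closedGraph {p : A × B} (hp : p ∈ closedGraph hi hj) :
    p.1 ∈ uniformClosure (Set.range i) := by
  refine closedGraph_subset hi hj
    ((isUniformlyClosed_uniformClosure (Set.range i)).preimage Prod.fst ?_)
    (fun x => subset_uniformClosure _ ⟨x, rfl⟩) hp
  rintro ι _ f x ⟨e, he, h⟩
  refine ⟨e.1, he.1, fun ε hε => ?_⟩
  obtain ⟨k, hk⟩ := h ε hε
  exact ⟨k, fun l hl => (hk l hl).1⟩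

/-- The first components of the closed graph already form a uniformly closed set: the second
components of a convergent net of first components are Cauchy, hence converge in `B`, and the pair
of limits stays in the graph. -/
theorem exists_mem_closedGraph [IsArchimedean B] (hB : UniformlyComplete B) {a : A}
    (ha : a ∈ uniformClosure (Set.range i)) : ∃ b, (a, b) ∈ closedGraph hi hj := by
  refine uniformClosure_subset (B := {a | ∃ b, (a, b) ∈ closedGraph hi hj}) ?_ ?_ ha
  · rintro ι _ _ _ f a hf ⟨e, he, h⟩
    choose g hg using hf
    obtain ⟨u, hu⟩ := hi.exists_le e
    have hu0 : 0 ≤ u := hi.le_iff.1 (by simpa using he.trans hu)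
    have hc : IsCauchyRel (j u) g := by
      intro ε hε
      obtain ⟨k, hk⟩ := (h.mono hu).isCauchyRel ε hε
      refine ⟨k, fun l hl m hm => ?_⟩
      have h1 : (f l - f m, g l - g m) ∈ closedGraph hi hj := sub_mem (hg l) (hg m)
      -- The modulus is `t ⊔ -t`, so the sublattice contains it. The infimum property then carries
      -- `|f l - f m| ≤ i (ε • u)` over to `|g l - g m| ≤ j (ε • u)`.
      have h2 : (|f l - f m|, |g l - g m|) ∈ closedGraph hi hj :=
        (closedGraph hi hj).sup_mem h1 (neg_mem h1)
      rw [← map_smul]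
      refine (isGLB_of_mem_closedGraph hi hj h2).1 ⟨_, ?_, rfl⟩
      rw [Set.mem_ofPred_eq, map_smul]
      exact hk l hl m hm
    have hj0 : 0 ≤ j u := by simpa using hj.le_iff.2 hu0
    obtain ⟨b, hb⟩ := hB ι g (isCauchyNet_iff.2 ⟨_, hj0, hc⟩)
    refine ⟨b, isUniformlyClosed_closedGraph hi hj ι (fun k => (f k, g k)) (a, b) hg
      ⟨(e, j u), ⟨he, hj0⟩, convergesRel_prod.2 ⟨h, hc.convergesRel hb⟩⟩⟩
  · rintro _ ⟨x, rfl⟩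
    exact ⟨_, map_mem_closedGraph hi hj x⟩

include hi hj in
/-- Two majorizing embeddings into uniformly complete vector lattices have isomorphic uniform
closures. -/
theorem exists_equiv_uniformClosure [IsArchimedean A] [IsArchimedean B]
    (hA : UniformlyComplete A) (hB : UniformlyComplete B)
    (S : VectorSublattice A) (T : VectorSublattice B)
    (hS : (S : Set A) = uniformClosure (Set.range i))
    (hT : (T : Set B) = uniformClosure (Set.range j)) :
    ∃ e : S ≃ₗ[ℝ] T, (∀ a b, e (a ⊔ b) = e a ⊔ e b) ∧ (∀ a b, e (a ⊓ b) = e a ⊓ e b) ∧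
      ∀ (x : X) (hx : i x ∈ S), (e ⟨i x, hx⟩ : B) = j x := by
  let G := closedGraph hi hj
  have h1 : ∀ a : S, ∃ b : T, ((a : A), (b : B)) ∈ G := by
    rintro ⟨a, ha⟩
    rw [← SetLike.mem_coe, hS] at ha
    obtain ⟨b, hb⟩ := exists_mem_closedGraph hi hj hB ha
    have hb' := fst_mem_of_mem_closedGraph hj hi (swap_mem_closedGraph hi hj hb)
    exact ⟨⟨b, by rw [← SetLike.mem_coe, hT]; exact hb'⟩, hb⟩
  have h2 : ∀ b : T, ∃ a : S, ((a : A), (b : B)) ∈ G := by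
    rintro ⟨b, hb⟩
    rw [← SetLike.mem_coe, hT] at hb
    obtain ⟨a, ha⟩ := exists_mem_closedGraph hj hi hA hb
    have ha' := swap_mem_closedGraph hj hi ha
    have ha'' := fst_mem_of_mem_closedGraph hi hj ha'
    exact ⟨⟨a, by rw [← SetLike.mem_coe, hS]; exact ha''⟩, ha'⟩
  choose φ hφ using h1
  choose ψ hψ using h2
  -- Each algebraic or lattice identity for `φ` reduces to the membership of one pair in the
  -- sublattice `G`.
  have key : ∀ {a : S} {b : T}, ((a : A), (b : B)) ∈ G → φ a = b := fun h =>
    Subtype.ext (closedGraph_right_unique hi hj (hφ _) h)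
  refine ⟨{ toFun := φ
            invFun := ψ
            map_add' := fun a b => key (add_mem (hφ a) (hφ b))
            map_smul' := fun r a => key (SMulMemClass.smul_mem r (hφ a))
            left_inv := fun a => Subtype.ext (closedGraph_left_unique hi hj (hψ _) (hφ _))
            right_inv := fun b => key (hψ b) }, ?_, ?_, ?_⟩
  · exact fun a b => key (G.sup_mem (hφ a) (hφ b))
  · exact fun a b => key (G.inf_mem (hφ a) (hφ b))
  · exact fun x hx => closedGraph_right_unique hi hj (hφ ⟨i x, hx⟩) (map_mem_closedGraph hi hj x)

end Embedding

/-! ### The uniform completion as a uniform closure -/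

section Completion

variable {X : Type u} [AddCommGroup X] [Lattice X] [IsOrderedAddMonoid X]
  [Module ℝ X] [IsOrderedModule ℝ X]

/-- An order complete vector lattice is uniformly complete. -/
theorem uniformlyComplete_of_exists_isLUB
    (h : ∀ s : Set X, s.Nonempty → BddAbove s → ∃ a, IsLUB s a) : UniformlyComplete X := by
  intro ι _ _ _ f hf
  obtain ⟨e, he, hf⟩ := isCauchyNet_iff.1 hf
  have hlow : ∀ ε : ℝ, 0 < ε → ∃ k, ∀ l, k ≤ l → ∀ m, k ≤ m → f l ≤ f m + ε • e := fun ε hε => by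
    obtain ⟨k, hk⟩ := hf ε hε
    exact ⟨k, fun l hl m hm => (abs_sub_le_iff'.1 (hk l hl m hm)).1⟩
  -- These are the eventual lower bounds of the net; their supremum is its limit inferior. For late
  -- `l` it is caught between `f l - ε • e`, which lies in `s`, and `f l + ε • e`, which bounds `s`
  -- above.
  let s : Set X := {z | ∃ k, ∀ l, k ≤ l → z ≤ f l}
  have hs : ∀ ε : ℝ, 0 < ε → ∃ k, ∀ l, k ≤ l →
      f l - ε • e ∈ s ∧ f l + ε • e ∈ upperBounds s := by
    intro ε hε
    obtain ⟨k, hk⟩ := hlow ε hε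
    refine ⟨k, fun l hl => ⟨⟨k, fun m hm => sub_le_iff_le_add.2 (hk l hl m hm)⟩, ?_⟩⟩
    rintro z ⟨m, hm⟩
    obtain ⟨n, hkn, hmn⟩ := exists_ge_ge k m
    exact (hm n hmn).trans (hk n hkn l hl)
  obtain ⟨k, hk⟩ := hs 1 one_pos
  obtain ⟨a, ha⟩ := h s ⟨_, (hk k le_rfl).1⟩ ⟨_, (hk k le_rfl).2⟩
  refine ⟨a, e, he, fun ε hε => ?_⟩
  obtain ⟨k, hk⟩ := hs ε hε
  exact ⟨k, fun l hl => abs_sub_le_iff'.2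
    ⟨sub_le_iff_le_add.1 (ha.1 (hk l hl).1), ha.2 (hk l hl).2⟩⟩

theorem VectorSublattice.isMajorizingEmbedding_subtype (S : VectorSublattice X)
    (hS : S.IsMajorizing) : IsMajorizingEmbedding
      ({ toFun := Subtype.val, map_add' := fun _ _ => rfl, map_smul' := fun _ _ => rfl } :
        S →ₗ[ℝ] X) where
  map_sup _ _ := rfl
  map_inf _ _ := rfl
  le_iff := Iff.rfl
  exists_le a := by
    -- Majorization concerns positive elements only, so it is applied to `|a| ≥ a`.
    obtain ⟨y, hy, h⟩ := hS |a| (abs_nonneg a)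
    exact ⟨⟨y, hy⟩, (le_abs_self a).trans h⟩

variable [IsArchimedean X]

/-- A majorizing uniformly complete sublattice is uniformly closed. -/
theorem VectorSublattice.isUniformlyClosed_of_uniformlyComplete {S : VectorSublattice X}
    (hS : S.IsMajorizing) (hc : UniformlyComplete S) : IsUniformlyClosed (S : Set X) := by
  rintro ι _ _ _ f x hf ⟨e, he, h⟩
  -- With a regulator in `S`, the net is Cauchy in `S` itself. Its limit there agrees with `x` by
  -- uniqueness of limits.
  obtain ⟨u, hu, heu⟩ := hS e he
  replace h := h.mono heu
  have hg : IsCauchyRel (⟨u, hu⟩ : S) (fun k => (⟨f k, hf k⟩ : S)) := h.isCauchyRel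
  obtain ⟨y, hy⟩ := hc ι _ (isCauchyNet_iff.2 ⟨_, he.trans heu, hg⟩)
  have hy' : ConvergesRel u f y := hg.convergesRel hy
  rw [h.unique hy']
  exact y.2

/-- A uniformly closed sublattice of a uniformly complete vector lattice is uniformly complete. -/
theorem VectorSublattice.uniformlyComplete_of_isUniformlyClosed {S : VectorSublattice X}
    (hS : IsUniformlyClosed (S : Set X)) (hc : UniformlyComplete X) : UniformlyComplete S := by
  intro ι _ _ _ f hf
  obtain ⟨e, he, h⟩ := isCauchyNet_iff.1 hf
  have h' : IsCauchyRel (e : X) (fun k => (f k : X)) := h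
  obtain ⟨x, hx⟩ := hc ι _ (isCauchyNet_iff.2 ⟨_, he, h'⟩)
  -- The regulator of the limit in `X` need not lie in `S`, so it is replaced by the Cauchy
  -- regulator `e`, which does.
  exact ⟨⟨x, hS ι _ x (fun k => (f k).2) hx⟩, e, he, h'.convergesRel hx⟩

theorem uniformlyComplete_dedekindCompletion : UniformlyComplete (DedekindCompletion X) :=
  uniformlyComplete_of_exists_isLUB DedekindCompletion.exists_isLUB

theorem isMajorizingEmbedding_embed :
    IsMajorizingEmbedding (DedekindCompletion.embed X) where
  map_sup := DedekindCompletion.of_sup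
  map_inf := DedekindCompletion.of_inf
  le_iff := DedekindCompletion.of_le_iff
  exists_le a := by
    obtain ⟨x, hx⟩ := a.right_nonempty
    exact ⟨x, DedekindCompletion.le_of_iff.2 hx⟩

variable (X) in
/-- The canonical copy of `X` in its Dedekind completion. -/
def embedRange : VectorSublattice (DedekindCompletion X) where
  toSubmodule := LinearMap.range (DedekindCompletion.embed X)
  supClosed' := by
    rintro _ ⟨x, rfl⟩ _ ⟨y, rfl⟩
    exact ⟨x ⊔ y, DedekindCompletion.of_sup x y⟩
  infClosed' := by
    rintro _ ⟨x, rfl⟩ _ ⟨y, rfl⟩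
    exact ⟨x ⊓ y, DedekindCompletion.of_inf x y⟩

variable (X) in
/-- The uniform completion is the uniform closure of `X` in its Dedekind completion. -/
theorem coe_uniformCompletion : (uniformCompletion X : Set (DedekindCompletion X)) =
    uniformClosure (Set.range (DedekindCompletion.embed X)) := by
  apply Set.Subset.antisymm
  · intro a ha
    -- The closure is itself one of the sublattices being intersected.
    refine ha (embedRange X).uniformClosure ⟨?_, fun x => subset_uniformClosure _ ⟨x, rfl⟩⟩
    exact VectorSublattice.uniformlyComplete_of_isUniformlyClosed
      (isUniformlyClosed_uniformClosure _) uniformlyComplete_dedekindCompletion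
  · rintro a ha S ⟨hS, hXS⟩
    -- Every competing `S` contains the majorizing copy of `X`, so it is majorizing and hence
    -- uniformly closed.
    refine uniformClosure_subset
      (VectorSublattice.isUniformlyClosed_of_uniformlyComplete ?_ hS) ?_ ha
    · intro b _
      obtain ⟨x, hx⟩ := isMajorizingEmbedding_embed.exists_le b
      exact ⟨_, hXS x, hx⟩
    · rintro _ ⟨x, rfl⟩
      exact hXS x

end Completion

end VectorLattice

open VectorLattice in
theorem mainTheorem5 {Y : Type*} [AddCommGroup Y] [Lattice Y] [IsOrderedAddMonoid Y]
    [Module ℝ Y] [IsOrderedModule ℝ Y] [IsArchimedean Y] (hY : UniformlyComplete Y)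
    (X : VectorSublattice Y) (hX : X.IsMajorizing) :
    ∃ e : uniformCompletion X ≃ₗ[ℝ] X.uniformClosure,
      (∀ a b, e (a ⊔ b) = e a ⊔ e b) ∧ (∀ a b, e (a ⊓ b) = e a ⊓ e b) ∧
      ∀ x : X, (e (toUniformCompletion x) : Y) = x := by
  -- Here `i` is the embedding of `X` into its Dedekind completion and `j` is the inclusion of `X`
  -- into `Y`.
  obtain ⟨e, hsup, hinf, he⟩ := exists_equiv_uniformClosure
    (isMajorizingEmbedding_embed (X := X)) (X.isMajorizingEmbedding_subtype hX)
    uniformlyComplete_dedekindCompletion hY (uniformCompletion X) X.uniformClosure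
    (coe_uniformCompletion X)
    (congrArg VectorLattice.uniformClosure Subtype.range_coe.symm)
  exact ⟨e, hsup, hinf, fun x => he x _⟩
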